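/- Let $d$ be the dimension of a finite-dimensional quantum system with computational basis $\{|b\rangle\}$ ($d = 2^n$ and $b\in\{0,1\}^n$ for $n$ qubits), and let $\rho$ be a $d\times d$ density matrix. Draw a unitary $U$ from the Haar probability measure on the $d\times d$ unitary group, measure $U\rho U^\dagger$ in the computational basis to get an outcome $\hat b$ (so that $\Pr[\hat b=b\mid U]=\langle b|U\rho U^\dagger|b\rangle$), and let $$\hat\rho=(d+1)\,U^\dagger|\hat b\rangle\langle\hat b|U-\mathbb I$$ be the resulting (uniform-POVM) classical shadow. Let $O$ be a Hermitian $d\times d$ matrix and $B$ a real number with $\operatorname{tr}(O^2)\le B$, and let $\hat o=\operatorname{tr}(O\hat\rho)$. Then $\hat o$ is an integrable random variable, and for every $\tau\ge 0$, $$\Pr\big[\,|\hat o-\mathbb E[\hat o]|\ge\tau\,\big]\le 2\exp\left(-\frac{\tau^2}{16B+4\sqrt B\,\tau}\right),$$ where the fraction is read as $0$ when its denominator is $0$. -/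

import Mathlib

open Matrix MeasureTheory
open scoped ComplexOrder

namespace UniformShadow

section Unitary

variable {ι : Type*} [Fintype ι] [DecidableEq ι]

noncomputable instance instMeasurableSpaceUnitary : MeasurableSpace (unitaryGroup ι ℂ) := borel _

instance instBorelSpaceUnitary : BorelSpace (unitaryGroup ι ℂ) := ⟨rfl⟩

instance instSecondCountableUnitary : SecondCountableTopology (unitaryGroup ι ℂ) := by
  have : SecondCountableTopology (Matrix ι ι ℂ) :=
    inferInstanceAs (SecondCountableTopology (ι → ι → ℂ))
  exact TopologicalSpace.Subtype.secondCountableTopology _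

instance instCompactSpaceUnitary : CompactSpace (unitaryGroup ι ℂ) := by
  have hK : IsCompact (Set.univ.pi fun _ : ι => Set.univ.pi fun _ : ι =>
      Metric.closedBall (0 : ℂ) 1) :=
    isCompact_univ_pi fun _ => isCompact_univ_pi fun _ => isCompact_closedBall 0 1
  refine isCompact_iff_compactSpace.mp (hK.of_isClosed_subset (isClosed_unitary (R := Matrix ι ι ℂ)) ?_)
  intro U hU i _ j _
  simpa using entry_norm_bound_of_unitary hU i j

variable (ι) in
/-- The Haar probability measure on the group of unitary matrices. -/
noncomputable def haarUnitary : Measure (unitaryGroup ι ℂ) :=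
  Measure.haarMeasure ⊤

end Unitary

section Shadow

variable {ι : Type*} [Fintype ι] [DecidableEq ι]

/-- A density matrix: positive semidefinite with unit trace. -/
def IsDensityMatrix (ρ : Matrix ι ι ℂ) : Prop :=
  ρ.PosSemidef ∧ ρ.trace = 1

/-- The Born probability `⟨b| U ρ U† |b⟩` of outcome `b` when `U ρ U†` is measured in the
computational basis. -/
noncomputable def bornProb (ρ : Matrix ι ι ℂ) (U : unitaryGroup ι ℂ) (b : ι) : ℝ :=
  (((U : Matrix ι ι ℂ) * ρ * (U : Matrix ι ι ℂ)ᴴ) b b).re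

/-- The joint law of `(U, b)`: the unitary `U` is Haar random and, given `U`, the outcome `b`
has its Born probability. It is given by its density with respect to Haar times counting
measure. -/
noncomputable def shadowLaw [MeasurableSpace ι] (ρ : Matrix ι ι ℂ) :
    Measure (unitaryGroup ι ℂ × ι) :=
  ((haarUnitary ι).prod Measure.count).withDensity
    fun ω => ENNReal.ofReal (bornProb ρ ω.1 ω.2)

/-- The inverse channel `X ↦ (d + 1) X - 1`, where `d` is the dimension. -/
noncomputable def invChannel (X : Matrix ι ι ℂ) : Matrix ι ι ℂ :=
  ((Fintype.card ι : ℂ) + 1) • X - 1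

/-- The classical shadow: the inverse channel applied to `U† |b⟩⟨b| U`. -/
noncomputable def shadow (ω : unitaryGroup ι ℂ × ι) : Matrix ι ι ℂ :=
  invChannel ((ω.1 : Matrix ι ι ℂ)ᴴ * Matrix.single ω.2 ω.2 1 * (ω.1 : Matrix ι ι ℂ))

/-- The estimate `tr (O ρ̂)`; the trace is real when `O` is Hermitian. -/
noncomputable def estimate (O : Matrix ι ι ℂ) (ω : unitaryGroup ι ℂ × ι) : ℝ :=
  (O * shadow ω).trace.re

end Shadow

end UniformShadow

/-!
Only the state `φ = U† |b⟩` matters: the estimate is `(d + 1) ⟨φ|O|φ⟩ - tr O`, and under the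
joint law `φ` has density `d ⟨φ|ρ|φ⟩` with respect to the uniform distribution on the unit
sphere. The tail bound is Chernoff's bound applied to a Bernstein-type estimate of the moment
generating function.

The exponential moment is compared with a Gaussian one. A standard complex Gaussian vector is
`g = r φ` with `φ` uniform and `r` independent of `φ` (`lintegral_eq_lintegral_haarUnitary`).
Weighting its law by `⟨g|ρ|g⟩ = r² ⟨φ|ρ|φ⟩` gives `φ` the law of the outcome state and makes
`r²` a Gamma variable of shape `d + 1`, whose mean `d + 1` is exactly the factor in the
estimate. Hence `E exp (s (d + 1) ⟨φ|O|φ⟩) ≤ E exp (s ⟨g|O|g⟩)`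
(`lintegral_haarUnitary_le_gaussian`). In an eigenbasis of `O`, with eigenvalues `l i` and
`p i` the diagonal of `ρ`, the right-hand side is `∏ i, (1 - s l i)⁻¹ * ∑ i, p i (1 - s l i)⁻¹`
(`lintegral_gaussian_exp_quadForm`).

As `∑ i, (l i)² ≤ B`, and so `|l i| ≤ √B`, the expansion `(1 - t)⁻¹ = 1 + t + t² / (1 - t)`
bounds the moment generating function centred at `tr (O ρ)` by `exp (2 s² B / (1 - |s| √B))`
(`prod_mul_sum_le_exp`, `lintegral_exp_estimate_le`). This also forces the mean to be
`tr (O ρ)` (`integral_estimate`). With `s = τ / (4 B + √B τ)` each tail is at most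
`exp (-τ² / (8 B + 2 √B τ))`, which is stronger than required.
-/

namespace UniformShadow

/-! ### Gaussian integrals over complex coordinates -/

section Gaussian

lemma integral_norm_pow_mul_exp (m : ℕ) {a : ℝ} (ha : 0 < a) :
    ∫ z : ℂ, ‖z‖ ^ m * Real.exp (-a * ‖z‖ ^ 2) =
      Real.pi * a ^ (-((m : ℝ) + 2) / 2) * Real.Gamma (((m : ℝ) + 2) / 2) := by
  have h := Complex.integral_rpow_mul_exp_neg_mul_rpow (p := 2) (q := m) (by norm_num)
    (by linarith [(Nat.cast_nonneg m : (0 : ℝ) ≤ m)]) ha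
  simp only [Real.rpow_natCast, Real.rpow_two] at h
  rw [h]
  ring

lemma integrable_norm_pow_mul_exp (m : ℕ) {a : ℝ} (ha : 0 < a) :
    Integrable fun z : ℂ => ‖z‖ ^ m * Real.exp (-a * ‖z‖ ^ 2) := by
  refine .of_integral_ne_zero ?_
  rw [integral_norm_pow_mul_exp m ha]
  have : 0 < ((m : ℝ) + 2) / 2 := by positivity
  have := Real.Gamma_pos_of_pos this
  positivity

lemma integral_exp_neg_mul_norm_sq {a : ℝ} (ha : 0 < a) :
    ∫ z : ℂ, Real.exp (-a * ‖z‖ ^ 2) = Real.pi / a := by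
  have h := integral_norm_pow_mul_exp 0 ha
  norm_num [Real.rpow_neg_one] at h
  simpa [div_eq_mul_inv] using h

lemma integral_norm_sq_mul_exp {a : ℝ} (ha : 0 < a) :
    ∫ z : ℂ, ‖z‖ ^ 2 * Real.exp (-a * ‖z‖ ^ 2) = Real.pi / a * a⁻¹ := by
  have h := integral_norm_pow_mul_exp 2 ha
  norm_num at h
  simp_rw [neg_mul]
  rw [h]
  field_simp

variable {ι : Type*} [DecidableEq ι]

/-- One coordinate of the integrand `conj (x i) * x j * exp (-∑ k, a k * ‖x k‖ ^ 2)`. -/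
noncomputable def gaussianFactor (a : ι → ℝ) (i j k : ι) (z : ℂ) : ℂ :=
  (if k = i then star z else 1) * (if k = j then z else 1) * (Real.exp (-a k * ‖z‖ ^ 2) : ℝ)

lemma integrable_gaussianFactor {a : ι → ℝ} (ha : ∀ k, 0 < a k) (i j k : ι) :
    Integrable (gaussianFactor a i j k) := by
  have hm : AEStronglyMeasurable (gaussianFactor a i j k) volume := by
    apply Continuous.aestronglyMeasurable
    unfold gaussianFactor
    split_ifs <;> fun_prop
  refine (integrable_norm_pow_mul_exp
    ((if k = i then 1 else 0) + (if k = j then 1 else 0)) (ha k)).mono' hm (.of_forall fun z => ?_)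
  rw [gaussianFactor, norm_mul, norm_mul, pow_add, Complex.norm_real,
    Real.norm_of_nonneg (Real.exp_pos _).le]
  split_ifs <;> simp

variable [Fintype ι]

lemma prod_gaussianFactor (a : ι → ℝ) (i j : ι) (x : ι → ℂ) :
    ∏ k, gaussianFactor a i j k (x k) =
      star (x i) * x j * (Real.exp (-∑ k, a k * ‖x k‖ ^ 2) : ℝ) := by
  simp only [gaussianFactor, Finset.prod_mul_distrib, Finset.prod_ite_eq', Finset.mem_univ, if_true,
    ← Complex.ofReal_prod, ← Real.exp_sum, neg_mul, Finset.sum_neg_distrib]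

lemma integrable_gaussian_coord {a : ι → ℝ} (ha : ∀ k, 0 < a k) (i j : ι) :
    Integrable fun x : ι → ℂ =>
      star (x i) * x j * ((Real.exp (-∑ k, a k * ‖x k‖ ^ 2) : ℝ) : ℂ) := by
  simp_rw [← prod_gaussianFactor]
  exact Integrable.fintype_prod fun k => integrable_gaussianFactor ha i j k

/-- The covariance of an unnormalized complex Gaussian vector with independent coordinates. The
off-diagonal entries vanish because the integrand is odd in each of the two coordinates. -/
lemma integral_gaussian_coord {a : ι → ℝ} (ha : ∀ k, 0 < a k) (i j : ι) :
    ∫ x : ι → ℂ, star (x i) * x j * ((Real.exp (-∑ k, a k * ‖x k‖ ^ 2) : ℝ) : ℂ) =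
      if i = j then (((∏ k, Real.pi / a k) * (a i)⁻¹ : ℝ) : ℂ) else 0 := by
  simp_rw [← prod_gaussianFactor]
  rw [integral_fintype_prod_volume_eq_prod]
  split_ifs with h
  · subst h
    have hk : ∀ k, ∫ z, gaussianFactor a i i k z =
        ((Real.pi / a k * (if k = i then (a i)⁻¹ else 1) : ℝ) : ℂ) := by
      intro k
      by_cases hki : k = i
      · subst hki
        simp only [if_true]
        rw [← integral_norm_sq_mul_exp (ha k), ← integral_complex_ofReal]
        congr 1 with z
        simp only [gaussianFactor, if_true, Complex.star_def, Complex.conj_mul']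
        push_cast
        ring
      · simp only [if_neg hki, mul_one]
        rw [← integral_exp_neg_mul_norm_sq (ha k), ← integral_complex_ofReal]
        congr 1 with z
        simp [gaussianFactor, hki]
    simp_rw [hk]
    rw [← Complex.ofReal_prod, Finset.prod_mul_distrib, Finset.prod_ite_eq']
    simp
  · refine Finset.prod_eq_zero (Finset.mem_univ i) ?_
    have hodd : ∀ z, gaussianFactor a i j i (-z) = -gaussianFactor a i j i z := by
      intro z
      simp [gaussianFactor, h]
    have h2 := integral_neg_eq_self (gaussianFactor a i j i) (volume : Measure ℂ)
    simp_rw [hodd] at h2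
    rw [integral_neg] at h2
    exact self_eq_neg.mp h2.symm

end Gaussian

/-! ### Hermitian forms and their Gaussian integrals -/

section QuadForm

variable {ι : Type*} [Fintype ι]

/-- The real part of `⟨x| A |x⟩`; it is all of `⟨x| A |x⟩` when `A` is Hermitian. -/
noncomputable def quadForm (A : Matrix ι ι ℂ) (x : ι → ℂ) : ℝ :=
  (star x ⬝ᵥ A *ᵥ x).re

/-- The squared Euclidean norm. The type `ι → ℂ` itself carries the supremum norm. -/
noncomputable def sqNorm (x : ι → ℂ) : ℝ := ∑ i, ‖x i‖ ^ 2

lemma sqNorm_nonneg (x : ι → ℂ) : 0 ≤ sqNorm x :=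
  Finset.sum_nonneg fun _ _ => by positivity

lemma continuous_quadForm (A : Matrix ι ι ℂ) : Continuous (quadForm A) := by
  unfold quadForm
  fun_prop

lemma continuous_sqNorm : Continuous (sqNorm : (ι → ℂ) → ℝ) := by
  unfold sqNorm
  fun_prop

lemma quadForm_eq_sum (A : Matrix ι ι ℂ) (x : ι → ℂ) :
    quadForm A x = (∑ i, ∑ j, A i j * (star (x i) * x j)).re := by
  simp only [quadForm, dotProduct, mulVec, Finset.mul_sum, Pi.star_apply]
  congr 1
  refine Finset.sum_congr rfl fun i _ => Finset.sum_congr rfl fun j _ => ?_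
  ring

lemma quadForm_real_smul (A : Matrix ι ι ℂ) (r : ℝ) (x : ι → ℂ) :
    quadForm A ((r : ℂ) • x) = r ^ 2 * quadForm A x := by
  simp only [quadForm, star_smul, mulVec_smul, smul_dotProduct, dotProduct_smul,
    smul_eq_mul, Complex.star_def, Complex.conj_ofReal, Complex.re_ofReal_mul]
  ring

lemma quadForm_mulVec (A V : Matrix ι ι ℂ) (x : ι → ℂ) :
    quadForm A (V *ᵥ x) = quadForm (Vᴴ * A * V) x := by
  simp only [quadForm, star_mulVec, ← dotProduct_mulVec, mulVec_mulVec, Matrix.mul_assoc]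

lemma quadForm_nonneg {A : Matrix ι ι ℂ} (hA : A.PosSemidef) (x : ι → ℂ) :
    0 ≤ quadForm A x :=
  (Complex.le_def.mp (hA.dotProduct_mulVec_nonneg x)).1

lemma gaussian_quadForm_eq_re (A : Matrix ι ι ℂ) (a : ι → ℝ) (x : ι → ℂ) :
    quadForm A x * Real.exp (-∑ k, a k * ‖x k‖ ^ 2) = RCLike.re (∑ i, ∑ j,
      A i j * (star (x i) * x j * ((Real.exp (-∑ k, a k * ‖x k‖ ^ 2) : ℝ) : ℂ))) := by
  simp_rw [← mul_assoc, ← Finset.sum_mul, RCLike.re_eq_complex_re, Complex.re_mul_ofReal,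
    quadForm_eq_sum, ← mul_assoc]

variable [DecidableEq ι]

lemma quadForm_diagonal (a : ι → ℝ) (x : ι → ℂ) :
    quadForm (diagonal fun i => (a i : ℂ)) x = ∑ i, a i * ‖x i‖ ^ 2 := by
  simp only [quadForm, mulVec_diagonal, dotProduct, Pi.star_apply, Complex.re_sum]
  refine Finset.sum_congr rfl fun i _ => ?_
  rw [show star (x i) * ((a i : ℂ) * x i) = a i * (star (x i) * x i) by ring, Complex.star_def,
    Complex.conj_mul', Complex.re_ofReal_mul, ← Complex.ofReal_pow, Complex.ofReal_re]

lemma quadForm_one (x : ι → ℂ) : quadForm 1 x = sqNorm x := by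
  rw [← diagonal_one]
  simpa [sqNorm] using quadForm_diagonal (fun _ => 1) x

lemma sqNorm_unitary_mulVec (V : unitaryGroup ι ℂ) (x : ι → ℂ) :
    sqNorm ((V : Matrix ι ι ℂ) *ᵥ x) = sqNorm x := by
  have hV : (V : Matrix ι ι ℂ)ᴴ * V = 1 := mem_unitaryGroup_iff'.mp V.2
  rw [← quadForm_one, quadForm_mulVec, Matrix.mul_one, hV, quadForm_one]

lemma integrable_gaussian_quadForm (A : Matrix ι ι ℂ) {a : ι → ℝ} (ha : ∀ k, 0 < a k) :
    Integrable fun x : ι → ℂ => ∑ i, ∑ j,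
      A i j * (star (x i) * x j * ((Real.exp (-∑ k, a k * ‖x k‖ ^ 2) : ℝ) : ℂ)) :=
  integrable_finsetSum _ fun i _ => integrable_finsetSum _ fun j _ =>
    (integrable_gaussian_coord ha i j).const_mul _

lemma integral_gaussian_quadForm (A : Matrix ι ι ℂ) {a : ι → ℝ} (ha : ∀ k, 0 < a k) :
    ∫ x : ι → ℂ, quadForm A x * Real.exp (-∑ k, a k * ‖x k‖ ^ 2) =
      (∏ k, Real.pi / a k) * ∑ i, (A i i).re / a i := by
  have hint : ∀ i j, Integrable fun x : ι → ℂ =>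
      A i j * (star (x i) * x j * ((Real.exp (-∑ k, a k * ‖x k‖ ^ 2) : ℝ) : ℂ)) :=
    fun i j => (integrable_gaussian_coord ha i j).const_mul _
  have hsum : ∫ x : ι → ℂ, ∑ i, ∑ j,
      A i j * (star (x i) * x j * ((Real.exp (-∑ k, a k * ‖x k‖ ^ 2) : ℝ) : ℂ)) =
      ∑ i, ∑ j, A i j * if i = j then (((∏ k, Real.pi / a k) * (a i)⁻¹ : ℝ) : ℂ) else 0 := by
    rw [integral_finsetSum Finset.univ fun i _ => integrable_finsetSum _ fun j _ => hint i j]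
    refine Finset.sum_congr rfl fun i _ => ?_
    rw [integral_finsetSum Finset.univ fun j _ => hint i j]
    refine Finset.sum_congr rfl fun j _ => ?_
    rw [integral_const_mul, integral_gaussian_coord ha]
  simp_rw [gaussian_quadForm_eq_re]
  rw [integral_re (integrable_gaussian_quadForm A ha), hsum]
  simp only [mul_ite, mul_zero, Finset.sum_ite_eq, Finset.mem_univ, if_true,
    RCLike.re_eq_complex_re, Complex.re_sum, Complex.re_mul_ofReal, Finset.mul_sum]
  refine Finset.sum_congr rfl fun i _ => ?_
  ring

lemma lintegral_gaussian_quadForm {A : Matrix ι ι ℂ} (hA : A.PosSemidef) {a : ι → ℝ}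
    (ha : ∀ k, 0 < a k) :
    ∫⁻ x : ι → ℂ, ENNReal.ofReal (quadForm A x * Real.exp (-∑ k, a k * ‖x k‖ ^ 2)) =
      ENNReal.ofReal ((∏ k, Real.pi / a k) * ∑ i, (A i i).re / a i) := by
  rw [← integral_gaussian_quadForm A ha, ofReal_integral_eq_lintegral_ofReal]
  · simp_rw [gaussian_quadForm_eq_re]
    exact (integrable_gaussian_quadForm A ha).re
  · exact .of_forall fun x => mul_nonneg (quadForm_nonneg hA x) (Real.exp_pos _).le

/-- The radial part of a Gaussian integral, without the normalization `π ^ d`: with `c = 0` it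
says that the squared norm of a Gaussian vector has mean `d`, and the factor `exp (c * sqNorm x)`
produces its moment generating function under the size-biased law, that of a Gamma
variable of shape `d + 1`. -/
lemma lintegral_gaussian_sqNorm {c : ℝ} (hc : c < 1) :
    ∫⁻ x : ι → ℂ, ENNReal.ofReal (sqNorm x * Real.exp (c * sqNorm x - sqNorm x)) =
      ENNReal.ofReal (Real.pi ^ Fintype.card ι *
        (Fintype.card ι / (1 - c) ^ (Fintype.card ι + 1))) := by
  have h := lintegral_gaussian_quadForm (PosSemidef.one (n := ι) (R := ℂ)) (a := fun _ => 1 - c)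
    fun _ => sub_pos.mpr hc
  have hc' : (1 - c) ≠ 0 := (sub_pos.mpr hc).ne'
  simp only [quadForm_one, ← Finset.mul_sum, one_apply_eq, Complex.one_re, Finset.prod_const,
    Finset.card_univ, Finset.sum_const, nsmul_eq_mul] at h
  calc _ = _ := by
        congr with x
        simp only [sqNorm]
        ring_nf
    _ = _ := h
    _ = _ := by
        congr 1
        rw [div_pow, pow_succ]
        field_simp

/-- Lebesgue measure on `ℂ^ι` is invariant under unitary matrices. A real-linear automorphism
multiplies Lebesgue measure by a constant, and that constant is `1` since the Gaussian integral,
which is finite and positive, does not change. -/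
lemma lintegral_unitary_mulVec [Nonempty ι] (V : unitaryGroup ι ℂ) {F : (ι → ℂ) → ENNReal}
    (hF : Measurable F) :
    ∫⁻ x, F ((V : Matrix ι ι ℂ) *ᵥ x) = ∫⁻ x, F x := by
  let f : (ι → ℂ) →ₗ[ℝ] (ι → ℂ) := (Matrix.mulVecLin (V : Matrix ι ι ℂ)).restrictScalars ℝ
  let g : (ι → ℂ) →ₗ[ℝ] (ι → ℂ) := (Matrix.mulVecLin (V : Matrix ι ι ℂ)ᴴ).restrictScalars ℝ
  have hfm : Measurable f := f.continuous_of_finiteDimensional.measurable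
  have hfg : f ∘ₗ g = LinearMap.id := by
    have hV : (V : Matrix ι ι ℂ) * (V : Matrix ι ι ℂ)ᴴ = 1 := mem_unitaryGroup_iff.mp V.2
    refine LinearMap.ext fun x => ?_
    simp [f, g, mulVec_mulVec, hV]
  have hdet : LinearMap.det f ≠ 0 := by
    intro h0
    have := congrArg LinearMap.det hfg
    rw [LinearMap.det_comp, h0, zero_mul, LinearMap.det_id] at this
    exact zero_ne_one this
  have hmap := Measure.map_linearMap_addHaar_eq_smul_addHaar (volume : Measure (ι → ℂ)) hdet
  have key : ∀ G : (ι → ℂ) → ENNReal, Measurable G →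
      ∫⁻ x, G (f x) = ENNReal.ofReal |(LinearMap.det f)⁻¹| * ∫⁻ x, G x := by
    intro G hG
    rw [← lintegral_map hG hfm, hmap, lintegral_smul_measure, smul_eq_mul]
  have hc : ENNReal.ofReal |(LinearMap.det f)⁻¹| = 1 := by
    have h := key (fun x => ENNReal.ofReal (sqNorm x * Real.exp (0 * sqNorm x - sqNorm x)))
      (by have := (continuous_sqNorm (ι := ι)).measurable; fun_prop)
    have hN : ∀ x, sqNorm (f x) = sqNorm x := sqNorm_unitary_mulVec V
    simp only [hN] at h
    rw [lintegral_gaussian_sqNorm zero_lt_one] at h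
    have hpos : 0 < Real.pi ^ Fintype.card ι *
        ((Fintype.card ι : ℝ) / (1 - 0) ^ (Fintype.card ι + 1)) := by
      have : 0 < Fintype.card ι := Fintype.card_pos
      simp only [sub_zero, one_pow]
      positivity
    exact ((ENNReal.mul_eq_right (ENNReal.ofReal_pos.mpr hpos).ne' ENNReal.ofReal_ne_top).mp h.symm)
  have := key F hF
  rwa [hc, one_mul] at this

end QuadForm

/-! ### Averaging over the unitary group -/

section Haar

variable {ι : Type*} [Fintype ι] [DecidableEq ι]

instance instIsProbabilityMeasureHaarUnitary : IsProbabilityMeasure (haarUnitary ι) where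
  measure_univ := Measure.haarMeasure_self

instance instIsMulLeftInvariantHaarUnitary : (haarUnitary ι).IsMulLeftInvariant :=
  inferInstanceAs (Measure.haarMeasure ⊤).IsMulLeftInvariant

/-- The state `U† |b⟩` selected by the unitary `U` and the outcome `b`. -/
noncomputable def outcomeState (U : unitaryGroup ι ℂ) (b : ι) : ι → ℂ :=
  (U : Matrix ι ι ℂ)ᴴ *ᵥ Pi.single b 1

lemma continuous_outcomeState (b : ι) :
    Continuous fun U : unitaryGroup ι ℂ => outcomeState U b := by
  unfold outcomeState
  fun_prop

lemma sqNorm_outcomeState (U : unitaryGroup ι ℂ) (b : ι) : sqNorm (outcomeState U b) = 1 := by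
  refine (sqNorm_unitary_mulVec (star U) _).trans ?_
  rw [sqNorm, Finset.sum_eq_single b] <;> simp +contextual

/-- The unitary group acts transitively on each sphere. -/
lemma exists_unitary_mulVec_single (b : ι) (x : ι → ℂ) :
    ∃ V : unitaryGroup ι ℂ,
      (Real.sqrt (sqNorm x) : ℂ) • (V : Matrix ι ι ℂ) *ᵥ Pi.single b 1 = x := by
  have hnorm : Real.sqrt (sqNorm x) = ‖WithLp.toLp 2 x‖ := by
    rw [EuclideanSpace.norm_eq, sqNorm]
  rcases eq_or_ne x 0 with rfl | hx
  · exact ⟨1, by simp [sqNorm]⟩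
  have hr : Real.sqrt (sqNorm x) ≠ 0 := by
    rw [hnorm, norm_ne_zero_iff]
    simpa using hx
  let v : EuclideanSpace ℂ ι := ((Real.sqrt (sqNorm x))⁻¹ : ℂ) • WithLp.toLp 2 x
  have hv : ‖v‖ = 1 := by
    rw [norm_smul, norm_inv, Complex.norm_real, Real.norm_of_nonneg (Real.sqrt_nonneg _), ← hnorm,
      inv_mul_cancel₀ hr]
  obtain ⟨w, hw⟩ := Orthonormal.exists_orthonormalBasis_extension_of_card_eq (𝕜 := ℂ)
    (E := EuclideanSpace ℂ ι) (ι := ι) (by simp) (v := fun _ => v) (s := {b})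
    ⟨fun _ => hv, fun i j hij => (hij (Subsingleton.elim i j)).elim⟩
  refine ⟨⟨_, (EuclideanSpace.basisFun ι ℂ).toMatrix_orthonormalBasis_mem_unitary w⟩, ?_⟩
  ext i
  have hwb : w b i = (Real.sqrt (sqNorm x) : ℂ)⁻¹ * x i := by
    rw [hw b rfl]
    simp [v]
  have hr' : (Real.sqrt (sqNorm x) : ℂ) ≠ 0 := Complex.ofReal_ne_zero.mpr hr
  simp [Module.Basis.toMatrix_apply, hwb, hr']

/-- Polar decomposition of Lebesgue measure on `ℂ^ι`: a vector may be replaced by one of the same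
norm whose direction `U† |b⟩` comes from an independent Haar unitary. -/
lemma lintegral_eq_lintegral_haarUnitary (b : ι) {F : (ι → ℂ) → ENNReal} (hF : Measurable F) :
    ∫⁻ x, F x =
      ∫⁻ U, ∫⁻ x : ι → ℂ, F ((Real.sqrt (sqNorm x) : ℂ) • outcomeState U b)
        ∂volume ∂haarUnitary ι := by
  have : Nonempty ι := ⟨b⟩
  have hN : Continuous (sqNorm : (ι → ℂ) → ℝ) := continuous_sqNorm
  have hb := continuous_outcomeState b
  calc ∫⁻ x, F x
      = ∫⁻ U, ∫⁻ x : ι → ℂ, F ((U : Matrix ι ι ℂ)ᴴ *ᵥ x) ∂volume ∂haarUnitary ι := by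
        have h : ∀ U : unitaryGroup ι ℂ, ∫⁻ x, F ((U : Matrix ι ι ℂ)ᴴ *ᵥ x) = ∫⁻ x, F x :=
          fun U => lintegral_unitary_mulVec (star U) hF
        simp [h]
    _ = ∫⁻ x : ι → ℂ, ∫⁻ U, F (((U : unitaryGroup ι ℂ) : Matrix ι ι ℂ)ᴴ *ᵥ x) ∂haarUnitary ι :=
        lintegral_lintegral_swap (hF.comp (by
          apply Continuous.measurable
          fun_prop)).aemeasurable
    _ = ∫⁻ x : ι → ℂ, ∫⁻ U, F ((Real.sqrt (sqNorm x) : ℂ) • outcomeState U b) ∂haarUnitary ι := by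
        congr with x
        obtain ⟨V, hV⟩ := exists_unitary_mulVec_single b x
        rw [← lintegral_mul_left_eq_self
          (fun U => F ((Real.sqrt (sqNorm x) : ℂ) • outcomeState U b)) (star V)]
        congr with U
        have hU : outcomeState (star V * U) b =
            (U : Matrix ι ι ℂ)ᴴ *ᵥ ((V : Matrix ι ι ℂ) *ᵥ Pi.single b 1) := by
          simp only [outcomeState, mulVec_mulVec, Submonoid.coe_mul, Unitary.coe_star,
            star_eq_conjTranspose, conjTranspose_mul, conjTranspose_conjTranspose]
        rw [hU, ← mulVec_smul, hV]
    _ = _ := by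
        refine lintegral_lintegral_swap (hF.comp ?_).aemeasurable
        apply Continuous.measurable
        fun_prop

end Haar

/-! ### The exponential moment of the estimate -/

section ExponentialMoment

variable {ι : Type*} [Fintype ι]

/-- The scalar inequality behind the bound. With `t = s * l i` and `K = 1 - |s| * √B`, which is at
most `1 - t`, one has `(1 - t)⁻¹ ≤ 1 + t + t² / K`, and `1 + u ≤ exp u` is applied to each factor
of the product and to the mean. -/
lemma prod_mul_sum_le_exp {B s : ℝ} (l p : ι → ℝ) (hp : ∀ i, 0 ≤ p i) (hp1 : ∑ i, p i = 1)
    (hl : ∑ i, l i ^ 2 ≤ B) (hs : |s| * Real.sqrt B < 1) :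
    (∏ i, (1 - s * l i)⁻¹) * ∑ i, p i * (1 - s * l i)⁻¹ ≤
      Real.exp (s * ∑ i, l i + s * ∑ i, p i * l i + 2 * s ^ 2 * B / (1 - |s| * Real.sqrt B)) := by
  have hl1 : ∀ i, l i ^ 2 ≤ B := fun i =>
    (Finset.single_le_sum (fun j _ => sq_nonneg (l j)) (Finset.mem_univ i)).trans hl
  have hK : 0 < 1 - |s| * Real.sqrt B := sub_pos.mpr hs
  set K := 1 - |s| * Real.sqrt B with hKdef
  have hle : ∀ i, K ≤ 1 - s * l i := fun i => by
    have h1 : s * l i ≤ |s| * |l i| := by rw [← abs_mul]; exact le_abs_self _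
    have h2 : |l i| ≤ Real.sqrt B := Real.abs_le_sqrt (hl1 i)
    have h3 := mul_le_mul_of_nonneg_left h2 (abs_nonneg s)
    linarith
  have hinv : ∀ i, (1 - s * l i)⁻¹ ≤ 1 + s * l i + s ^ 2 * l i ^ 2 / K := fun i => by
    have hpos : 0 < 1 - s * l i := hK.trans_le (hle i)
    have h1 : (1 - s * l i)⁻¹ = 1 + s * l i + s ^ 2 * l i ^ 2 / (1 - s * l i) := by
      field_simp
      ring
    rw [h1]
    have := hle i
    gcongr
  have hprod : ∏ i, (1 - s * l i)⁻¹ ≤ Real.exp (s * ∑ i, l i + s ^ 2 * B / K) := by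
    calc ∏ i, (1 - s * l i)⁻¹ ≤ ∏ i, Real.exp (s * l i + s ^ 2 * l i ^ 2 / K) := by
          refine Finset.prod_le_prod (fun i _ => ?_) fun i _ => ?_
          · exact (inv_pos.mpr (hK.trans_le (hle i))).le
          refine (hinv i).trans ?_
          linarith [Real.add_one_le_exp (s * l i + s ^ 2 * l i ^ 2 / K)]
      _ = Real.exp (s * ∑ i, l i + s ^ 2 * (∑ i, l i ^ 2) / K) := by
          rw [← Real.exp_sum, Finset.sum_add_distrib, ← Finset.mul_sum, ← Finset.sum_div,
            ← Finset.mul_sum]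
      _ ≤ _ := by gcongr
  have hsum : ∑ i, p i * (1 - s * l i)⁻¹ ≤ Real.exp (s * ∑ i, p i * l i + s ^ 2 * B / K) := by
    calc ∑ i, p i * (1 - s * l i)⁻¹ ≤ ∑ i, p i * (1 + s * l i + s ^ 2 * B / K) := by
          refine Finset.sum_le_sum fun i _ => mul_le_mul_of_nonneg_left ((hinv i).trans ?_) (hp i)
          have := hl1 i
          gcongr
      _ = 1 + s * ∑ i, p i * l i + s ^ 2 * B / K := by
          simp_rw [mul_add, mul_one, Finset.sum_add_distrib, hp1, ← Finset.sum_mul, hp1,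
            Finset.mul_sum, one_mul]
          congr 2
          exact Finset.sum_congr rfl fun i _ => by ring
      _ ≤ _ := by linarith [Real.add_one_le_exp (s * ∑ i, p i * l i + s ^ 2 * B / K)]
  calc _ ≤ Real.exp (s * ∑ i, l i + s ^ 2 * B / K) *
        Real.exp (s * ∑ i, p i * l i + s ^ 2 * B / K) := by
        refine mul_le_mul hprod hsum (Finset.sum_nonneg fun i _ => ?_) (Real.exp_pos _).le
        exact mul_nonneg (hp i) (inv_pos.mpr (hK.trans_le (hle i))).le
    _ = _ := by
        rw [← Real.exp_add]
        ring_nf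

variable [DecidableEq ι]

/-- Replacing a Haar random direction by a Gaussian vector can only increase the size-biased
exponential moment: along a fixed direction `φ` the Gaussian radius contributes
`(1 - s ⟨φ|O|φ⟩)⁻¹ ^ (d + 1)`, which is at least `exp (s (d + 1) ⟨φ|O|φ⟩)`. -/
lemma lintegral_haarUnitary_le_gaussian {ρ : Matrix ι ι ℂ} (hρ : ρ.PosSemidef)
    (O : Matrix ι ι ℂ) {s : ℝ} (hs : ∀ x, sqNorm x = 1 → s * quadForm O x < 1) (b : ι) :
    ENNReal.ofReal (Real.pi ^ Fintype.card ι * Fintype.card ι) *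
        ∫⁻ U, ENNReal.ofReal (quadForm ρ (outcomeState U b) *
          Real.exp (s * ((Fintype.card ι + 1) * quadForm O (outcomeState U b)))) ∂haarUnitary ι ≤
      ∫⁻ x : ι → ℂ, ENNReal.ofReal (quadForm ρ x * Real.exp (s * quadForm O x - sqNorm x)) := by
  have hQρ := (continuous_quadForm ρ).measurable
  have hQO := (continuous_quadForm O).measurable
  have hN := (continuous_sqNorm (ι := ι)).measurable
  rw [lintegral_eq_lintegral_haarUnitary b (by fun_prop),
    ← lintegral_const_mul' _ _ ENNReal.ofReal_ne_top]
  refine lintegral_mono fun U => ?_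
  set φ := outcomeState U b with hφ
  have hφ1 : sqNorm φ = 1 := sqNorm_outcomeState U b
  have hscale : ∀ x : ι → ℂ, sqNorm ((Real.sqrt (sqNorm x) : ℂ) • φ) = sqNorm x := fun x => by
    rw [← quadForm_one, quadForm_real_smul, Real.sq_sqrt (sqNorm_nonneg x), quadForm_one, hφ1,
      mul_one]
  have hq := quadForm_nonneg hρ φ
  have hlt := hs φ hφ1
  have hinner : ∫⁻ x : ι → ℂ, ENNReal.ofReal (quadForm ρ ((Real.sqrt (sqNorm x) : ℂ) • φ) *
      Real.exp (s * quadForm O ((Real.sqrt (sqNorm x) : ℂ) • φ) -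
        sqNorm ((Real.sqrt (sqNorm x) : ℂ) • φ))) =
      ENNReal.ofReal (quadForm ρ φ) * ENNReal.ofReal (Real.pi ^ Fintype.card ι *
        (Fintype.card ι / (1 - s * quadForm O φ) ^ (Fintype.card ι + 1))) := by
    rw [← lintegral_gaussian_sqNorm hlt, ← lintegral_const_mul' _ _ ENNReal.ofReal_ne_top]
    congr with x
    rw [← ENNReal.ofReal_mul hq, hscale, quadForm_real_smul, quadForm_real_smul,
      Real.sq_sqrt (sqNorm_nonneg x)]
    congr 1
    rw [show s * (sqNorm x * quadForm O φ) = s * quadForm O φ * sqNorm x by ring]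
    ring
  rw [hinner, ← ENNReal.ofReal_mul (by positivity), ← ENNReal.ofReal_mul hq]
  apply ENNReal.ofReal_le_ofReal
  have hpos : 0 < 1 - s * quadForm O φ := sub_pos.mpr hlt
  have hexp : Real.exp (s * ((Fintype.card ι + 1) * quadForm O φ)) ≤
      1 / (1 - s * quadForm O φ) ^ (Fintype.card ι + 1) := by
    have h1 : 1 - s * quadForm O φ ≤ Real.exp (-(s * quadForm O φ)) := by
      linarith [Real.add_one_le_exp (-(s * quadForm O φ))]
    have h2 : (1 - s * quadForm O φ) ^ (Fintype.card ι + 1) ≤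
        Real.exp (-(s * ((Fintype.card ι + 1) * quadForm O φ))) := by
      refine (pow_le_pow_left₀ hpos.le h1 _).trans_eq ?_
      rw [← Real.exp_nat_mul]
      push_cast
      ring_nf
    rw [Real.exp_neg] at h2
    rw [one_div]
    exact (le_inv_comm₀ (by positivity) (Real.exp_pos _)).mp h2
  calc Real.pi ^ Fintype.card ι * Fintype.card ι * (quadForm ρ φ *
        Real.exp (s * ((Fintype.card ι + 1) * quadForm O φ)))
      ≤ Real.pi ^ Fintype.card ι * Fintype.card ι * (quadForm ρ φ *
        (1 / (1 - s * quadForm O φ) ^ (Fintype.card ι + 1))) := by gcongr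
    _ = _ := by ring

/-- The diagonal of `ρ` in an eigenbasis of `O`, that is, the distribution of the outcome of
measuring the observable `O` in the state `ρ`. -/
noncomputable def eigenProb {O : Matrix ι ι ℂ} (hO : O.IsHermitian) (ρ : Matrix ι ι ℂ)
    (i : ι) : ℝ :=
  (((hO.eigenvectorUnitary : Matrix ι ι ℂ)ᴴ * ρ * (hO.eigenvectorUnitary : Matrix ι ι ℂ)) i i).re

section Diagonalization

variable {O : Matrix ι ι ℂ} (hO : O.IsHermitian)

lemma conjTranspose_mul_eigenvectorUnitary :
    (hO.eigenvectorUnitary : Matrix ι ι ℂ)ᴴ * (hO.eigenvectorUnitary : Matrix ι ι ℂ) = 1 :=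
  mem_unitaryGroup_iff'.mp hO.eigenvectorUnitary.2

lemma eigenvectorUnitary_mul_conjTranspose :
    (hO.eigenvectorUnitary : Matrix ι ι ℂ) * (hO.eigenvectorUnitary : Matrix ι ι ℂ)ᴴ = 1 :=
  mem_unitaryGroup_iff.mp hO.eigenvectorUnitary.2

lemma eq_eigenvectorUnitary_mul_diagonal_mul : O = (hO.eigenvectorUnitary : Matrix ι ι ℂ) *
    diagonal (fun i => (hO.eigenvalues i : ℂ)) * (hO.eigenvectorUnitary : Matrix ι ι ℂ)ᴴ := by
  conv_lhs => rw [hO.spectral_theorem, Unitary.conjStarAlgAut_apply]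
  rfl

lemma conj_eigenvectorUnitary : (hO.eigenvectorUnitary : Matrix ι ι ℂ)ᴴ * O *
    (hO.eigenvectorUnitary : Matrix ι ι ℂ) = diagonal fun i => (hO.eigenvalues i : ℂ) := by
  have h := hO.conjStarAlgAut_star_eigenvectorUnitary
  rw [Unitary.conjStarAlgAut_star_apply] at h
  exact h

lemma quadForm_eigenvectorUnitary_mulVec (x : ι → ℂ) :
    quadForm O ((hO.eigenvectorUnitary : Matrix ι ι ℂ) *ᵥ x) =
      ∑ i, hO.eigenvalues i * ‖x i‖ ^ 2 := by
  rw [quadForm_mulVec, conj_eigenvectorUnitary, quadForm_diagonal]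

lemma sum_eigenvalues : ∑ i, hO.eigenvalues i = O.trace.re := by
  rw [hO.trace_eq_sum_eigenvalues]
  simp

lemma sum_sq_eigenvalues : ∑ i, hO.eigenvalues i ^ 2 = (O * O).trace.re := by
  have h := conjTranspose_mul_eigenvectorUnitary hO
  have hOO : O * O = (hO.eigenvectorUnitary : Matrix ι ι ℂ) *
      (diagonal (fun i => (hO.eigenvalues i : ℂ)) * diagonal (fun i => (hO.eigenvalues i : ℂ))) *
      (hO.eigenvectorUnitary : Matrix ι ι ℂ)ᴴ := by
    conv_lhs => rw [eq_eigenvectorUnitary_mul_diagonal_mul hO]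
    simp only [Matrix.mul_assoc]
    rw [← Matrix.mul_assoc (hO.eigenvectorUnitary : Matrix ι ι ℂ)ᴴ, h, Matrix.one_mul]
  rw [hOO, trace_mul_comm, ← Matrix.mul_assoc, h, Matrix.one_mul, diagonal_mul_diagonal,
    trace_diagonal, Complex.re_sum]
  refine Finset.sum_congr rfl fun i _ => ?_
  rw [← Complex.ofReal_mul, Complex.ofReal_re, sq]

lemma eigenProb_nonneg {ρ : Matrix ι ι ℂ} (hρ : ρ.PosSemidef) (i : ι) : 0 ≤ eigenProb hO ρ i :=
  (Complex.le_def.mp (hρ.conjTranspose_mul_mul_same _).diag_nonneg).1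

lemma sum_eigenProb (ρ : Matrix ι ι ℂ) : ∑ i, eigenProb hO ρ i = ρ.trace.re := by
  simp only [eigenProb]
  rw [← Complex.re_sum]
  change (trace ((hO.eigenvectorUnitary : Matrix ι ι ℂ)ᴴ * ρ *
    (hO.eigenvectorUnitary : Matrix ι ι ℂ))).re = _
  rw [trace_mul_comm, ← Matrix.mul_assoc, eigenvectorUnitary_mul_conjTranspose, Matrix.one_mul]

lemma sum_eigenProb_mul_eigenvalues (ρ : Matrix ι ι ℂ) :
    ∑ i, eigenProb hO ρ i * hO.eigenvalues i = (O * ρ).trace.re := by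
  conv_rhs => rw [eq_eigenvectorUnitary_mul_diagonal_mul hO]
  rw [Matrix.mul_assoc, Matrix.mul_assoc, trace_mul_comm, Matrix.mul_assoc, trace, Complex.re_sum]
  refine Finset.sum_congr rfl fun i _ => ?_
  rw [diag_apply, diagonal_mul, Complex.re_ofReal_mul, eigenProb, mul_comm]

lemma lintegral_gaussian_exp_quadForm {ρ : Matrix ι ι ℂ} (hρ : ρ.PosSemidef) [Nonempty ι] {s : ℝ}
    (hs : ∀ i, s * hO.eigenvalues i < 1) :
    ∫⁻ x : ι → ℂ, ENNReal.ofReal (quadForm ρ x * Real.exp (s * quadForm O x - sqNorm x)) =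
      ENNReal.ofReal (Real.pi ^ Fintype.card ι * ((∏ i, (1 - s * hO.eigenvalues i)⁻¹) *
        ∑ i, eigenProb hO ρ i * (1 - s * hO.eigenvalues i)⁻¹)) := by
  have hQρ := (continuous_quadForm ρ).measurable
  have hQO := (continuous_quadForm O).measurable
  have hN := (continuous_sqNorm (ι := ι)).measurable
  rw [← lintegral_unitary_mulVec hO.eigenvectorUnitary (by fun_prop)]
  have h := lintegral_gaussian_quadForm (hρ.conjTranspose_mul_mul_same
    (hO.eigenvectorUnitary : Matrix ι ι ℂ)) (a := fun i => 1 - s * hO.eigenvalues i)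
    fun i => sub_pos.mpr (hs i)
  calc _ = _ := by
        congr with x
        rw [quadForm_eigenvectorUnitary_mulVec, sqNorm_unitary_mulVec, quadForm_mulVec]
        congr 3
        simp only [sqNorm, Finset.mul_sum, ← Finset.sum_sub_distrib, ← Finset.sum_neg_distrib]
        refine Finset.sum_congr rfl fun i _ => ?_
        ring
    _ = _ := h
    _ = _ := by
        simp only [div_eq_mul_inv, Finset.prod_mul_distrib, Finset.prod_const, Finset.card_univ,
          mul_assoc, eigenProb]

lemma mul_quadForm_lt_one {s : ℝ} (hs : ∀ i, s * hO.eigenvalues i < 1) {x : ι → ℂ}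
    (hx : sqNorm x = 1) : s * quadForm O x < 1 := by
  set y := (hO.eigenvectorUnitary : Matrix ι ι ℂ)ᴴ *ᵥ x with hy
  have hxy : x = (hO.eigenvectorUnitary : Matrix ι ι ℂ) *ᵥ y := by
    rw [hy, mulVec_mulVec, eigenvectorUnitary_mul_conjTranspose, one_mulVec]
  rw [hxy, sqNorm_unitary_mulVec] at hx
  rw [hxy, quadForm_eigenvectorUnitary_mulVec, ← hx, sqNorm, Finset.mul_sum]
  have hne : ∃ i, y i ≠ 0 := by
    by_contra! h
    simp [sqNorm, h] at hx
  obtain ⟨i, hi⟩ := hne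
  refine Finset.sum_lt_sum (fun j _ => ?_) ⟨i, Finset.mem_univ i, ?_⟩
  · nlinarith [hs j, sq_nonneg ‖y j‖]
  · have : 0 < ‖y i‖ ^ 2 := by positivity
    nlinarith [hs i]

end Diagonalization

end ExponentialMoment

/-! ### The law of the shadow -/

section Law

variable {ι : Type*} [Fintype ι] [DecidableEq ι]

lemma quadForm_outcomeState (A : Matrix ι ι ℂ) (U : unitaryGroup ι ℂ) (b : ι) :
    quadForm A (outcomeState U b) = (((U : Matrix ι ι ℂ) * A * (U : Matrix ι ι ℂ)ᴴ) b b).re := by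
  rw [outcomeState, quadForm_mulVec, conjTranspose_conjTranspose, quadForm]
  congr 1
  rw [← Pi.single_star, star_one, single_one_dotProduct, mulVec_single_one, col_apply]

lemma bornProb_eq_quadForm (ρ : Matrix ι ι ℂ) (U : unitaryGroup ι ℂ) (b : ι) :
    bornProb ρ U b = quadForm ρ (outcomeState U b) :=
  (quadForm_outcomeState ρ U b).symm

lemma estimate_eq_quadForm (O : Matrix ι ι ℂ) (U : unitaryGroup ι ℂ) (b : ι) :
    estimate O (U, b) = (Fintype.card ι + 1) * quadForm O (outcomeState U b) - O.trace.re := by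
  have h : (O * ((U : Matrix ι ι ℂ)ᴴ * Matrix.single b b 1 * (U : Matrix ι ι ℂ))).trace =
      ((U : Matrix ι ι ℂ) * O * (U : Matrix ι ι ℂ)ᴴ) b b := by
    rw [← Matrix.mul_assoc, trace_mul_comm, ← Matrix.mul_assoc, ← Matrix.mul_assoc,
      trace_mul_single, MulOpposite.op_one, one_smul]
  rw [quadForm_outcomeState, ← h, estimate, shadow, invChannel, Matrix.mul_sub, Matrix.mul_one,
    Matrix.mul_smul, trace_sub, trace_smul, Complex.sub_re, smul_eq_mul]
  congr 1
  rw [← Complex.re_ofReal_mul]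
  push_cast
  rfl

lemma sum_bornProb (ρ : Matrix ι ι ℂ) (U : unitaryGroup ι ℂ) :
    ∑ b, bornProb ρ U b = ρ.trace.re := by
  have hU : (U : Matrix ι ι ℂ)ᴴ * U = 1 := mem_unitaryGroup_iff'.mp U.2
  simp only [bornProb]
  rw [← Complex.re_sum]
  change (trace ((U : Matrix ι ι ℂ) * ρ * (U : Matrix ι ι ℂ)ᴴ)).re = _
  rw [trace_mul_comm, ← Matrix.mul_assoc, hU, Matrix.one_mul]

lemma exists_abs_estimate_le (O : Matrix ι ι ℂ) : ∃ C, ∀ ω, |estimate O ω| ≤ C := by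
  have h : ∀ b, ∃ C, ∀ U : unitaryGroup ι ℂ, ‖quadForm O (outcomeState U b)‖ ≤ C := fun b => by
    obtain ⟨C, hC⟩ := isCompact_univ.exists_bound_of_continuousOn
      ((continuous_quadForm O).comp (continuous_outcomeState b)).continuousOn
    exact ⟨C, fun U => hC U (Set.mem_univ U)⟩
  choose C hC using h
  refine ⟨(Fintype.card ι + 1) * ∑ b, |C b| + |O.trace.re|, fun ⟨U, b⟩ => ?_⟩
  rw [estimate_eq_quadForm]
  refine (abs_sub _ _).trans ?_
  rw [abs_mul, abs_of_nonneg (by positivity : (0 : ℝ) ≤ Fintype.card ι + 1)]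
  gcongr
  exact ((hC b U).trans (le_abs_self _)).trans
    (Finset.single_le_sum (fun j _ => abs_nonneg (C j)) (Finset.mem_univ b))

variable [MeasurableSpace ι] [DiscreteMeasurableSpace ι]

lemma measurable_quadForm_outcomeState (A : Matrix ι ι ℂ) :
    Measurable fun ω : unitaryGroup ι ℂ × ι => quadForm A (outcomeState ω.1 ω.2) :=
  measurable_from_prod_countable_left fun b =>
    ((continuous_quadForm A).comp (continuous_outcomeState b)).measurable

lemma measurable_estimate (O : Matrix ι ι ℂ) : Measurable (estimate O) := by
  have h : estimate O = fun ω =>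
      (Fintype.card ι + 1) * quadForm O (outcomeState ω.1 ω.2) - O.trace.re :=
    funext fun ω => estimate_eq_quadForm O ω.1 ω.2
  rw [h]
  exact ((measurable_quadForm_outcomeState O).const_mul _).sub_const _

lemma lintegral_shadowLaw (ρ : Matrix ι ι ℂ) {f : unitaryGroup ι ℂ × ι → ENNReal}
    (hf : Measurable f) :
    ∫⁻ ω, f ω ∂shadowLaw ρ =
      ∑ b, ∫⁻ U, ENNReal.ofReal (quadForm ρ (outcomeState U b)) * f (U, b) ∂haarUnitary ι := by
  have hm := (measurable_quadForm_outcomeState ρ).ennreal_ofReal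
  have hb : ∀ b, Measurable fun U : unitaryGroup ι ℂ =>
      ENNReal.ofReal (quadForm ρ (outcomeState U b)) * f (U, b) := fun b =>
    ((continuous_quadForm ρ).comp (continuous_outcomeState b)).measurable.ennreal_ofReal.mul
      (hf.comp measurable_prodMk_right)
  simp only [shadowLaw, bornProb_eq_quadForm]
  rw [lintegral_withDensity_eq_lintegral_mul _ hm hf, lintegral_prod _ (hm.mul hf).aemeasurable,
    ← lintegral_finsetSum Finset.univ fun b _ => hb b]
  congr with U
  rw [lintegral_count, tsum_fintype]
  rfl

lemma isProbabilityMeasure_shadowLaw {ρ : Matrix ι ι ℂ} (hρ : IsDensityMatrix ρ) :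
    IsProbabilityMeasure (shadowLaw ρ) where
  measure_univ := by
    have hm : ∀ b, Measurable fun U : unitaryGroup ι ℂ =>
        ENNReal.ofReal (quadForm ρ (outcomeState U b)) := fun b =>
      ((continuous_quadForm ρ).comp (continuous_outcomeState b)).measurable.ennreal_ofReal
    rw [← lintegral_one, lintegral_shadowLaw ρ measurable_const]
    simp only [mul_one]
    rw [← lintegral_finsetSum Finset.univ fun b _ => hm b]
    simp_rw [← ENNReal.ofReal_sum_of_nonneg fun b _ => quadForm_nonneg hρ.1 _,
      ← bornProb_eq_quadForm, sum_bornProb, hρ.2]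
    simp

lemma integrable_estimate {ρ : Matrix ι ι ℂ} (hρ : IsDensityMatrix ρ) (O : Matrix ι ι ℂ) :
    Integrable (estimate O) (shadowLaw ρ) := by
  have := isProbabilityMeasure_shadowLaw hρ
  obtain ⟨C, hC⟩ := exists_abs_estimate_le O
  exact .of_bound (measurable_estimate O).aestronglyMeasurable C (.of_forall hC)

/-! ### The Bernstein bound -/

variable {ρ : Matrix ι ι ℂ} {O : Matrix ι ι ℂ} {B : ℝ}

/-- The moment generating function of the estimate, centred at `tr (O ρ)`. -/
lemma lintegral_exp_estimate_le (hρ : IsDensityMatrix ρ) (hO : O.IsHermitian)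
    (hB : (O * O).trace.re ≤ B) {s : ℝ} (hs : |s| * Real.sqrt B < 1) :
    ∫⁻ ω, ENNReal.ofReal (Real.exp (s * (estimate O ω - (O * ρ).trace.re))) ∂shadowLaw ρ ≤
      ENNReal.ofReal (Real.exp (2 * s ^ 2 * B / (1 - |s| * Real.sqrt B))) := by
  have : Nonempty ι := by
    by_contra h
    rw [not_nonempty_iff] at h
    simpa [trace] using hρ.2
  have hl2 : ∑ i, hO.eigenvalues i ^ 2 ≤ B := (sum_sq_eigenvalues hO).trans_le hB
  have hsl : ∀ i, s * hO.eigenvalues i < 1 := fun i => by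
    have h1 : s * hO.eigenvalues i ≤ |s| * |hO.eigenvalues i| := by
      rw [← abs_mul]
      exact le_abs_self _
    have h2 : |hO.eigenvalues i| ≤ Real.sqrt B := Real.abs_le_sqrt
      ((Finset.single_le_sum (fun j _ => sq_nonneg (hO.eigenvalues j))
        (Finset.mem_univ i)).trans hl2)
    have h3 := mul_le_mul_of_nonneg_left h2 (abs_nonneg s)
    linarith
  have hdpos : 0 < Fintype.card ι := Fintype.card_pos
  obtain ⟨P, hP⟩ : ∃ P, (∏ i, (1 - s * hO.eigenvalues i)⁻¹) *
    ∑ i, eigenProb hO ρ i * (1 - s * hO.eigenvalues i)⁻¹ = P := ⟨_, rfl⟩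
  obtain ⟨c, hc⟩ : ∃ c, c = Real.exp (-(s * (O.trace.re + (O * ρ).trace.re))) := ⟨_, rfl⟩
  have hc0 : 0 ≤ c := hc ▸ (Real.exp_pos _).le
  have hPle : P ≤ Real.exp (s * O.trace.re + s * (O * ρ).trace.re +
      2 * s ^ 2 * B / (1 - |s| * Real.sqrt B)) := by
    have h := prod_mul_sum_le_exp hO.eigenvalues (eigenProb hO ρ) (eigenProb_nonneg hO hρ.1)
      (by rw [sum_eigenProb, hρ.2, Complex.one_re]) hl2 hs
    rwa [sum_eigenvalues, sum_eigenProb_mul_eigenvalues, hP] at h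
  have hstep : ∀ b, ∫⁻ U, ENNReal.ofReal (quadForm ρ (outcomeState U b) *
      Real.exp (s * ((Fintype.card ι + 1) * quadForm O (outcomeState U b)))) ∂haarUnitary ι ≤
      ENNReal.ofReal (P / Fintype.card ι) := fun b => by
    have h := lintegral_haarUnitary_le_gaussian hρ.1 O
      (fun x hx => mul_quadForm_lt_one hO hsl hx) b
    have hpos : 0 < Real.pi ^ Fintype.card ι * (Fintype.card ι : ℝ) := by positivity
    rw [lintegral_gaussian_exp_quadForm hO hρ.1 hsl, hP] at h
    rw [← ENNReal.mul_le_mul_iff_right (ENNReal.ofReal_pos.mpr hpos).ne' ENNReal.ofReal_ne_top]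
    refine h.trans_eq ?_
    rw [← ENNReal.ofReal_mul hpos.le]
    congr 1
    field_simp
  have hQ := measurable_estimate O
  rw [lintegral_shadowLaw ρ (by fun_prop)]
  calc _ = ∑ b, ENNReal.ofReal c * ∫⁻ U, ENNReal.ofReal (quadForm ρ (outcomeState U b) *
        Real.exp (s * ((Fintype.card ι + 1) * quadForm O (outcomeState U b)))) ∂haarUnitary ι := by
        refine Finset.sum_congr rfl fun b _ => ?_
        rw [← lintegral_const_mul' _ _ ENNReal.ofReal_ne_top]
        congr with U
        rw [← ENNReal.ofReal_mul (quadForm_nonneg hρ.1 _), ← ENNReal.ofReal_mul hc0,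
          estimate_eq_quadForm, mul_left_comm, hc, ← Real.exp_add]
        congr 3
        ring
    _ ≤ ∑ b : ι, ENNReal.ofReal c * ENNReal.ofReal (P / Fintype.card ι) := by
        gcongr with b
        exact hstep b
    _ = ENNReal.ofReal (c * P) := by
        rw [Finset.sum_const, Finset.card_univ, nsmul_eq_mul, ← ENNReal.ofReal_natCast,
          ← ENNReal.ofReal_mul hc0, ← ENNReal.ofReal_mul (by positivity)]
        congr 1
        field_simp
    _ ≤ _ := by
        apply ENNReal.ofReal_le_ofReal
        calc c * P ≤ c * Real.exp (s * O.trace.re + s * (O * ρ).trace.re +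
              2 * s ^ 2 * B / (1 - |s| * Real.sqrt B)) := by gcongr
          _ = _ := by
              rw [hc, ← Real.exp_add]
              ring_nf

/-- Unbiasedness. It follows from the exponential moment, which bounds `t |E[ô] - tr (O ρ)|` by a
multiple of `t ^ 2` for small `t`, so no second moment of the Haar measure is needed. -/
lemma integral_estimate (hρ : IsDensityMatrix ρ) (hO : O.IsHermitian) :
    ∫ ω, estimate O ω ∂shadowLaw ρ = (O * ρ).trace.re := by
  have := isProbabilityMeasure_shadowLaw hρ
  set B := (O * O).trace.re with hB
  have hB0 : 0 ≤ B := by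
    rw [hB, ← sum_sq_eigenvalues hO]
    positivity
  set m := (O * ρ).trace.re with hm
  have hint := integrable_estimate hρ O
  have hbound : ∀ s : ℝ, |s| * (2 * Real.sqrt B + 1) ≤ 1 →
      s * (∫ ω, estimate O ω ∂shadowLaw ρ - m) ≤ 8 * B * s ^ 2 := fun s hs => by
    have hsq := Real.sq_sqrt hB0
    have hs0 := abs_nonneg s
    have hr0 := Real.sqrt_nonneg B
    have hs1 : |s| * Real.sqrt B ≤ 1 / 2 := by linarith
    have hmgf := lintegral_exp_estimate_le hρ hO hB.ge (s := s) (by linarith)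
    have hlin : 1 + s * (∫ ω, estimate O ω ∂shadowLaw ρ - m) ≤
        Real.exp (2 * s ^ 2 * B / (1 - |s| * Real.sqrt B)) := by
      have hi : Integrable (fun ω => 1 + s * (estimate O ω - m)) (shadowLaw ρ) :=
        (integrable_const _).add ((hint.sub (integrable_const _)).const_mul _)
      have he : ∫ ω, (1 + s * (estimate O ω - m)) ∂shadowLaw ρ =
          1 + s * (∫ ω, estimate O ω ∂shadowLaw ρ - m) := by
        have hi' : Integrable (fun ω => s * (estimate O ω - m)) (shadowLaw ρ) :=
          (hint.sub (integrable_const _)).const_mul _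
        rw [integral_add (integrable_const _) hi', integral_const_mul,
          integral_sub hint (integrable_const _)]
        simp
      obtain ⟨C, hC⟩ := exists_abs_estimate_le O
      have hmeas := measurable_estimate O
      have hexp : Integrable (fun ω => Real.exp (s * (estimate O ω - m))) (shadowLaw ρ) := by
        refine .of_bound (by fun_prop) (Real.exp (|s| * (C + |m|))) (.of_forall fun ω => ?_)
        rw [Real.norm_of_nonneg (Real.exp_pos _).le, Real.exp_le_exp]
        refine (le_abs_self _).trans ?_
        rw [abs_mul]
        gcongr
        exact (abs_sub _ _).trans (by gcongr; exact hC ω)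
      rw [← he]
      refine (integral_mono hi hexp fun ω => ?_).trans ?_
      · show 1 + s * (estimate O ω - m) ≤ Real.exp (s * (estimate O ω - m))
        linarith [Real.add_one_le_exp (s * (estimate O ω - m))]
      · rw [← ofReal_integral_eq_lintegral_ofReal hexp (.of_forall fun ω => (Real.exp_pos _).le)]
          at hmgf
        exact (ENNReal.ofReal_le_ofReal_iff (Real.exp_pos _).le).mp hmgf
    have hfrac : 2 * s ^ 2 * B / (1 - |s| * Real.sqrt B) ≤ 4 * B * s ^ 2 := by
      rw [div_le_iff₀ (by linarith)]
      have : 0 ≤ B * s ^ 2 := by positivity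
      nlinarith
    have hsmall : 4 * B * s ^ 2 ≤ 1 := by
      have : 4 * B * s ^ 2 = (2 * (|s| * Real.sqrt B)) ^ 2 := by
        rw [mul_pow, mul_pow, sq_abs, hsq]
        ring
      rw [this]
      exact pow_le_one₀ (by positivity) (by linarith)
    have hu0 : 0 ≤ 4 * B * s ^ 2 := by positivity
    have h2 := (abs_le.mp (Real.abs_exp_sub_one_le (x := 4 * B * s ^ 2)
      (by rwa [abs_of_nonneg hu0]))).2
    rw [abs_of_nonneg hu0] at h2
    have h3 := Real.exp_le_exp.mpr hfrac
    linarith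
  set D := ∫ ω, estimate O ω ∂shadowLaw ρ - m with hD
  have hr : 0 < 2 * Real.sqrt B + 1 := by positivity
  have hkey : ∀ t : ℝ, 0 < t → t * (2 * Real.sqrt B + 1) ≤ 1 → |D| ≤ 8 * B * t := fun t ht ht1 => by
    have h1 := hbound t (by rwa [abs_of_pos ht])
    have h2 := hbound (-t) (by rwa [abs_neg, abs_of_pos ht])
    refine le_of_mul_le_mul_left (a := t) ?_ ht
    rcases abs_cases D with ⟨h, -⟩ | ⟨h, -⟩ <;> rw [h] <;> nlinarith
  have hD0 : |D| ≤ 0 := by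
    have htend : Filter.Tendsto (fun t : ℝ => 8 * B * t) (nhdsWithin 0 (Set.Ioi 0)) (nhds 0) := by
      have : Filter.Tendsto (fun t : ℝ => 8 * B * t) (nhds 0) (nhds (8 * B * 0)) :=
        (continuous_const.mul continuous_id).tendsto 0
      rw [mul_zero] at this
      exact this.mono_left nhdsWithin_le_nhds
    refine ge_of_tendsto htend ?_
    filter_upwards [Ioc_mem_nhdsGT (inv_pos.mpr hr)] with t ht
    have h1 := mul_le_mul_of_nonneg_right ht.2 hr.le
    rw [inv_mul_cancel₀ hr.ne'] at h1
    exact hkey t ht.1 h1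
  exact sub_eq_zero.mp (abs_eq_zero.mp (le_antisymm hD0 (abs_nonneg D)))

/-- Chernoff's bound for one tail; the sign `ε = ±1` selects which. -/
lemma shadowLaw_tail_le (hρ : IsDensityMatrix ρ) (hO : O.IsHermitian)
    (hB : (O * O).trace.re ≤ B) (hB0 : 0 < B) {τ : ℝ} (hτ : 0 ≤ τ) {ε : ℝ} (hε : |ε| = 1) :
    shadowLaw ρ {ω | τ ≤ ε * (estimate O ω - (O * ρ).trace.re)} ≤
      ENNReal.ofReal (Real.exp (-(τ ^ 2 / (16 * B + 4 * Real.sqrt B * τ)))) := by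
  set r := Real.sqrt B with hr
  have hr0 : 0 < r := Real.sqrt_pos.mpr hB0
  -- the usual choice in Bernstein's inequality for the exponent `2 s² B / (1 - s √B) - s τ`
  set s := τ / (4 * B + r * τ) with hs
  have hden : 0 < 4 * B + r * τ := by positivity
  have hs0 : 0 ≤ s := by positivity
  have habs : |ε * s| = s := by rw [abs_mul, hε, one_mul, abs_of_nonneg hs0]
  have hsr : 1 - s * r = 4 * B / (4 * B + r * τ) := by
    rw [hs]
    field_simp
    ring
  have hsr0 : 0 < 1 - s * r := by
    rw [hsr]
    positivity
  have hmgf := lintegral_exp_estimate_le hρ hO hB (s := ε * s) (by rw [habs]; linarith)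
  have hε2 : ε ^ 2 = 1 := by rw [← sq_abs, hε, one_pow]
  rw [habs, mul_pow, hε2, one_mul, ← hr] at hmgf
  have hmeas := measurable_estimate O
  have hmarkov := mul_meas_ge_le_lintegral (μ := shadowLaw ρ) (f := fun ω =>
    ENNReal.ofReal (Real.exp (ε * s * (estimate O ω - (O * ρ).trace.re)))) (by fun_prop)
    (ENNReal.ofReal (Real.exp (s * τ)))
  have hsub : shadowLaw ρ {ω | τ ≤ ε * (estimate O ω - (O * ρ).trace.re)} ≤
      shadowLaw ρ {ω | ENNReal.ofReal (Real.exp (s * τ)) ≤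
        ENNReal.ofReal (Real.exp (ε * s * (estimate O ω - (O * ρ).trace.re)))} := by
    refine measure_mono fun ω hω => ?_
    apply ENNReal.ofReal_le_ofReal
    rw [Real.exp_le_exp, mul_comm ε s, mul_assoc]
    exact mul_le_mul_of_nonneg_left hω hs0
  have hfin : Real.exp (2 * s ^ 2 * B / (1 - s * r)) ≤
      Real.exp (s * τ) * Real.exp (-(τ ^ 2 / (16 * B + 4 * r * τ))) := by
    rw [← Real.exp_add, Real.exp_le_exp, hsr]
    have h1 : 2 * s ^ 2 * B / (4 * B / (4 * B + r * τ)) = τ ^ 2 / (4 * B + r * τ) / 2 := by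
      rw [hs]
      field_simp
      ring
    have h2 : s * τ = τ ^ 2 / (4 * B + r * τ) := by
      rw [hs]
      ring
    have h3 : τ ^ 2 / (16 * B + 4 * r * τ) = τ ^ 2 / (4 * B + r * τ) / 4 := by
      field_simp
      ring
    have h4 : 0 ≤ τ ^ 2 / (4 * B + r * τ) := by positivity
    rw [h1, h2, h3]
    linarith
  rw [← ENNReal.mul_le_mul_iff_right (ENNReal.ofReal_pos.mpr (Real.exp_pos (s * τ))).ne'
    ENNReal.ofReal_ne_top, ← ENNReal.ofReal_mul (Real.exp_pos _).le]
  refine (le_trans ?_ hmarkov).trans (hmgf.trans (ENNReal.ofReal_le_ofReal hfin))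
  gcongr

end Law
end UniformShadow

theorem mainTheorem11 {ι : Type*} [Fintype ι] [DecidableEq ι]
    [MeasurableSpace ι] [DiscreteMeasurableSpace ι]
    (ρ : Matrix ι ι ℂ) (hρ : UniformShadow.IsDensityMatrix ρ)
    (O : Matrix ι ι ℂ) (hO : O.IsHermitian)
    (B : ℝ) (hB : (O * O).trace.re ≤ B) :
    IsProbabilityMeasure (UniformShadow.shadowLaw ρ) ∧
    Integrable (UniformShadow.estimate O) (UniformShadow.shadowLaw ρ) ∧
    ∀ τ : ℝ, 0 ≤ τ →
      UniformShadow.shadowLaw ρ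
          {ω | τ ≤ |UniformShadow.estimate O ω -
            ∫ ω', UniformShadow.estimate O ω' ∂(UniformShadow.shadowLaw ρ)|} ≤
        ENNReal.ofReal (2 * Real.exp (-(τ ^ 2 / (16 * B + 4 * Real.sqrt B * τ)))) := by
  have hprob := UniformShadow.isProbabilityMeasure_shadowLaw hρ
  refine ⟨hprob, UniformShadow.integrable_estimate hρ O, fun τ hτ => ?_⟩
  have hB0 : 0 ≤ B := by
    refine le_trans ?_ hB
    rw [← UniformShadow.sum_sq_eigenvalues hO]
    positivity
  rcases hB0.eq_or_lt with rfl | hBpos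
  · -- the exponent is `τ ^ 2 / 0 = 0`, so the bound is `2`
    refine prob_le_one.trans ?_
    simp
  rw [UniformShadow.integral_estimate hρ hO]
  calc _ ≤ UniformShadow.shadowLaw ρ
        ({ω | τ ≤ 1 * (UniformShadow.estimate O ω - (O * ρ).trace.re)} ∪
          {ω | τ ≤ -1 * (UniformShadow.estimate O ω - (O * ρ).trace.re)}) := by
        refine measure_mono fun ω hω => ?_
        simpa [le_abs] using hω
    _ ≤ _ := measure_union_le _ _
    _ ≤ _ := add_le_add (UniformShadow.shadowLaw_tail_le hρ hO hB hBpos hτ (by simp))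
        (UniformShadow.shadowLaw_tail_le hρ hO hB hBpos hτ (by simp))
    _ = _ := by
        rw [← ENNReal.ofReal_add (Real.exp_pos _).le (Real.exp_pos _).le, two_mul]
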